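/- Let $k$ be an algebraically closed field. All algebras are finite-dimensional $k$-algebras, and $\operatorname{mod}\Lambda$ denotes the category of finitely generated right $\Lambda$-modules. An algebra $\Lambda$ is an \emph{Auslander algebra} if $\Lambda\cong\operatorname{End}_\Gamma(M_1\oplus\cdots\oplus M_n)$, where $\Gamma$ is an algebra of finite representation type and $M_1,\dots,M_n$ is a complete set of representatives of the isomorphism classes of indecomposable modules in $\operatorname{mod}\Gamma$. For $M\in\operatorname{mod}\Lambda$, let $\operatorname{add}M$ be the class of finite direct sums of direct summands of $M$, and let $\operatorname{Gen}M$ (respectively $\operatorname{Cogen}M$) be the class of modules $X\in\operatorname{mod}\Lambda$ admitting an epimorphism $M^d\to X$ (respectively a monomorphism $X\to M^d$) for some $d\ge 0$. A module $T\in\operatorname{mod}\Lambda$ is \emph{tilting} if $\operatorname{pd}T\le 1$, $\operatorname{Ext}^1_\Lambda(T,T)=0$, and there is a short exact sequence $0\to\Lambda_\Lambda\to T'\to T''\to 0$ with $T',T''\in\operatorname{add}T$. It is \emph{cotilting} if $\operatorname{id}T\le 1$, $\operatorname{Ext}^1_\Lambda(T,T)=0$, and there is a short exact sequence $0\to T'\to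 T''\to D\Lambda\to 0$ with $T',T''\in\operatorname{add}T$, where $D\Lambda=\operatorname{Hom}_k(\Lambda,k)$. A tilting module $T$ has the \emph{hereditary property} if for every $M\in\operatorname{Gen}T$ there is a short exact sequence $0\to T'\to T''\to M\to 0$ with $T',T''\in\operatorname{add}T$. Let $\tilde Q$ be the direct sum of representatives of the isomorphism classes of all indecomposable projective-injective modules in $\operatorname{mod}\Lambda$, and let $\mathcal C_\Lambda=\operatorname{Gen}\tilde Q\cap\operatorname{Cogen}\tilde Q$. \textbf{Theorem.} Let $\Lambda$ be an Auslander algebra. Then there exists a tilting $\Lambda$-module $T_{\mathcal C}$ with the hereditary property. More precisely, $T_{\mathcal C}$ can be taken to be both tilting and cotilting and to lie in $\mathcal C_\Lambda$; and it is the only such module up to multiplicities of summands: every tilting module $T'\in\mathcal C_\Lambda$ satisfies $\operatorname{add}T'=\operatorname{add}T_{\mathcal C}$. -/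

import Mathlib

open CategoryTheory CategoryTheory.Limits MulOpposite

universe u

noncomputable section

namespace AuslanderTilting

/-- The category of right modules over `Λ`, i.e. of left modules over the opposite ring. The
finitely generated ones form `mod Λ`. -/
abbrev RightMod (Λ : Type u) [Ring Λ] := ModuleCat.{u} Λᵐᵒᵖ

section General

variable {Λ : Type u} [Ring Λ]

/-- `M` lies in `mod Λ`. -/
def IsFG (M : RightMod Λ) : Prop := Module.Finite Λᵐᵒᵖ M

/-- The regular right module `Λ_Λ`. -/
def regular (Λ : Type u) [Ring Λ] : RightMod Λ := ModuleCat.of Λᵐᵒᵖ Λ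

/-- `Y` is (isomorphic to) a direct summand of `M`. -/
def IsSummand (M Y : RightMod Λ) : Prop := ∃ Z : RightMod Λ, Nonempty (M ≅ Y ⊞ Z)

/-- `X ∈ add M`: `X` is a finite direct sum of direct summands of `M`. -/
def InAdd (M X : RightMod Λ) : Prop :=
  ∃ (n : ℕ) (Y : Fin n → RightMod Λ), (∀ i, IsSummand M (Y i)) ∧ Nonempty (X ≅ ⨁ Y)

/-- `X ∈ Gen M`: there is an epimorphism `M ^ d → X` for some `d ≥ 0`. -/
def InGen (M X : RightMod Λ) : Prop :=
  IsFG X ∧ ∃ (d : ℕ) (f : (⨁ fun _ : Fin d => M) ⟶ X), Epi f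

/-- `X ∈ Cogen M`: there is a monomorphism `X → M ^ d` for some `d ≥ 0`. -/
def InCogen (M X : RightMod Λ) : Prop :=
  IsFG X ∧ ∃ (d : ℕ) (f : X ⟶ (⨁ fun _ : Fin d => M)), Mono f

/-- There is a short exact sequence `0 → A → B → C → 0`. -/
def HasSES (A B C : RightMod Λ) : Prop :=
  ∃ (f : A ⟶ B) (g : B ⟶ C) (w : f ≫ g = 0), (ShortComplex.mk f g w).ShortExact

/-- `T` is a tilting module: `T ∈ mod Λ`, `pd T ≤ 1`, `Ext¹(T, T) = 0`, and there is a short exact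
sequence `0 → Λ_Λ → T' → T'' → 0` with `T', T'' ∈ add T`. -/
structure IsTilting (T : RightMod Λ) : Prop where
  fg : IsFG T
  projDim_le_one : HasProjectiveDimensionLE T 1
  ext_self : Subsingleton (Abelian.Ext T T 1)
  coresolution : ∃ T' T'' : RightMod Λ, InAdd T T' ∧ InAdd T T'' ∧ HasSES (regular Λ) T' T''

/-- The members of the family `P` are finitely generated indecomposable right modules satisfying
`p`, and every such module is isomorphic to exactly one member of the family. -/
structure IsCompleteFamily (p : RightMod Λ → Prop) {n : ℕ} (P : Fin n → RightMod Λ) : Prop where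
  fg : ∀ i, IsFG (P i)
  indecomposable : ∀ i, Indecomposable (P i)
  prop : ∀ i, p (P i)
  eq_of_iso : ∀ i j, Nonempty (P i ≅ P j) → i = j
  complete : ∀ X : RightMod Λ, IsFG X → Indecomposable X → p X → ∃ i, Nonempty (X ≅ P i)

/-- `Q` is the direct sum of representatives of the isomorphism classes of all indecomposable
projective-injective modules in `mod Λ`; this determines `Q` up to isomorphism. -/
def IsSumOfProjInj (Q : RightMod Λ) : Prop :=
  ∃ (n : ℕ) (P : Fin n → RightMod Λ),
    IsCompleteFamily (fun X => Projective X ∧ Injective X) P ∧ Nonempty (Q ≅ ⨁ P)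

/-- `X` lies in the subcategory `C_Λ = Gen Q ∩ Cogen Q`, where `Q` is the direct sum of
representatives of the isomorphism classes of all indecomposable projective-injectives. -/
def InC (X : RightMod Λ) : Prop :=
  ∃ Q : RightMod Λ, IsSumOfProjInj Q ∧ InGen Q X ∧ InCogen Q X

/-- The hereditary property of a (tilting) module `T`: for every `M ∈ Gen T` there is a short
exact sequence `0 → T' → T'' → M → 0` with `T', T'' ∈ add T`. -/
def HasHereditaryProperty (T : RightMod Λ) : Prop :=
  ∀ M : RightMod Λ, InGen T M →
    ∃ T' T'' : RightMod Λ, InAdd T T' ∧ InAdd T T'' ∧ HasSES T' T'' M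

end General

section Algebra

variable (k : Type u) [Field k] (Λ : Type u) [Ring Λ] [Algebra k Λ]

/-- The underlying type of `D Λ = Hom_k(Λ, k)`. -/
def DualCarrier : Type u := Λ →ₗ[k] k

instance : AddCommGroup (DualCarrier k Λ) := inferInstanceAs (AddCommGroup (Λ →ₗ[k] k))

/-- The right action of `Λ` on `Hom_k(Λ, k)`: `(f · a) x = f (a * x)`. -/
instance : Module Λᵐᵒᵖ (DualCarrier k Λ) where
  smul a f := LinearMap.comp (show Λ →ₗ[k] k from f) (LinearMap.mulLeft k a.unop)
  one_smul f := LinearMap.ext fun x => congrArg (show Λ →ₗ[k] k from f) (one_mul x)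
  mul_smul a b f :=
    LinearMap.ext fun x => congrArg (show Λ →ₗ[k] k from f) (mul_assoc b.unop a.unop x)
  smul_zero _ := LinearMap.ext fun _ => rfl
  smul_add _ _ _ := LinearMap.ext fun _ => rfl
  add_smul a b f := LinearMap.ext fun x =>
    (congrArg (show Λ →ₗ[k] k from f) (add_mul a.unop b.unop x)).trans
      (map_add (show Λ →ₗ[k] k from f) _ _)
  zero_smul f := LinearMap.ext fun x =>
    (congrArg (show Λ →ₗ[k] k from f) (zero_mul x)).trans (map_zero (show Λ →ₗ[k] k from f))

/-- The right module `D Λ = Hom_k(Λ, k)`. -/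
def dualRegular : RightMod Λ := ModuleCat.of Λᵐᵒᵖ (DualCarrier k Λ)

variable {Λ} in
/-- `C` is a cotilting module: `C ∈ mod Λ`, `id C ≤ 1`, `Ext¹(C, C) = 0`, and there is a short
exact sequence `0 → C' → C'' → D Λ → 0` with `C', C'' ∈ add C`. -/
structure IsCotilting (C : RightMod Λ) : Prop where
  fg : IsFG C
  injDim_le_one : HasInjectiveDimensionLE C 1
  ext_self : Subsingleton (Abelian.Ext C C 1)
  resolution : ∃ C' C'' : RightMod Λ, InAdd C C' ∧ InAdd C C'' ∧ HasSES C' C'' (dualRegular k Λ)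

/-- `Λ` is an Auslander algebra over `k`: it is isomorphic to `End_Γ(M₁ ⊕ ⋯ ⊕ Mₙ)`, where `Γ` is a
finite-dimensional `k`-algebra of finite representation type and `M₁, …, Mₙ` is a complete set of
representatives of the isomorphism classes of indecomposable modules in `mod Γ`. -/
def IsAuslanderAlgebra : Prop :=
  ∃ (Γ : Type u) (_ : Ring Γ) (_ : Algebra k Γ) (_ : Module.Finite k Γ)
    (n : ℕ) (M : Fin n → RightMod Γ),
    IsCompleteFamily (fun _ => True) M ∧ Nonempty (Λ ≃ₐ[k] End (⨁ M))

end Algebra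

end AuslanderTilting

end

-- Write `Λ = End G`, with `G` the sum of all indecomposable `Γ`-modules. Since every finitely
-- generated `Γ`-module lies in `add G`, the functor `Hom(G, -)` sends it to a projective
-- `Λ`-module; as `G` is a separator, the functor is also full and preserves injectives. Kernels in
-- `mod Γ` then bound projective dimensions over `Λ` by two
-- (`projectiveDimension_le_two_of_auslander`), and an injective copresentation of `G` becomes an
-- exact sequence `0 → Λ → Q₀ → Q₁` with `Q₀`, `Q₁` projective-injective
-- (`hasDominantDimensionGETwo_of_auslander`).
--
-- Let `Z` be the cokernel of `Λ → Q₀` and `T = Q ⊞ Z`, where `Q` is the sum of the indecomposable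
-- projective-injectives. `T` is a quotient of `Q ⊞ Q₀` and a submodule of `Q ⊞ Q₁`, hence lies in
-- `C_Λ`; dimension shifting gives `pd T ≤ 1`, `Ext¹(T, T) = 0` and `id T ≤ 1` (`exists_tilting`).
--
-- For tilting `T`, `Gen T` is the class where `Ext¹(T, -)` vanishes, and `add T` consists of the
-- Ext-projectives of `Gen T` (`IsTilting.addRetract_of_ext`). A universal map from a power of `T`
-- onto `M ∈ Gen T` has kernel in `Gen T`; `id T ≤ 1` and global dimension at most two make that
-- kernel Ext-projective, which is the hereditary property. Applied to `D Λ`, it gives the cotilting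
-- resolution. Any tilting module in `C_Λ` has the same `Gen` as `Q`, whence uniqueness.

universe w v

noncomputable section

namespace AuslanderTilting

/-! ### Retracts of finite powers in a preadditive category. -/

section Preadditive

variable {C : Type u} [Category.{v} C] [Preadditive C]

/-- `X` is a retract of a finite power of `T`. -/
def AddRetract (T X : C) : Prop :=
  ∃ (ι : Type) (_ : Fintype ι) (a : ι → (X ⟶ T)) (b : ι → (T ⟶ X)), ∑ i, a i ≫ b i = 𝟙 X

namespace AddRetract

theorem refl (T : C) : AddRetract T T :=
  ⟨Unit, inferInstance, fun _ => 𝟙 T, fun _ => 𝟙 T, by simp⟩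

theorem of_retract {T X Y : C} (h : AddRetract T X) (i : Y ⟶ X) (r : X ⟶ Y) (w : i ≫ r = 𝟙 Y) :
    AddRetract T Y := by
  obtain ⟨ι, _, a, b, hab⟩ := h
  refine ⟨ι, inferInstance, fun j => i ≫ a j, fun j => b j ≫ r, ?_⟩
  have : ∑ j, (i ≫ a j) ≫ b j ≫ r = i ≫ (∑ j, a j ≫ b j) ≫ r := by
    simp [Preadditive.sum_comp, Preadditive.comp_sum]
  rw [this, hab, Category.id_comp, w]

theorem of_iso {T X Y : C} (h : AddRetract T X) (e : X ≅ Y) : AddRetract T Y :=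
  h.of_retract e.inv e.hom (by simp)

theorem trans {T X Y : C} (h : AddRetract T X) (h' : AddRetract X Y) : AddRetract T Y := by
  obtain ⟨ι, _, a, b, hab⟩ := h
  obtain ⟨κ, _, c, d, hcd⟩ := h'
  refine ⟨κ × ι, inferInstance, fun p => c p.1 ≫ a p.2, fun p => b p.2 ≫ d p.1, ?_⟩
  rw [Fintype.sum_prod_type, ← hcd]
  refine Finset.sum_congr rfl fun j _ => ?_
  calc ∑ i, (c j ≫ a i) ≫ b i ≫ d j = c j ≫ (∑ i, a i ≫ b i) ≫ d j := by
        simp [Preadditive.sum_comp, Preadditive.comp_sum]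
    _ = c j ≫ d j := by rw [hab, Category.id_comp]

theorem biproduct [HasFiniteBiproducts C] {T : C} {ι : Type} [Finite ι] {X : ι → C}
    (h : ∀ i, AddRetract T (X i)) : AddRetract T (⨁ X) := by
  have := Fintype.ofFinite ι
  choose κ _ a b hab using h
  refine ⟨Σ i, κ i, inferInstance, fun p => biproduct.π X p.1 ≫ a p.1 p.2,
    fun p => b p.1 p.2 ≫ biproduct.ι X p.1, ?_⟩
  rw [Fintype.sum_sigma, ← biproduct.total]
  refine Finset.sum_congr rfl fun i _ => ?_
  calc ∑ j, (biproduct.π X i ≫ a i j) ≫ b i j ≫ biproduct.ι X i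
      = biproduct.π X i ≫ (∑ j, a i j ≫ b i j) ≫ biproduct.ι X i := by
        simp [Preadditive.sum_comp, Preadditive.comp_sum]
    _ = _ := by rw [hab, Category.id_comp]

theorem power [HasFiniteBiproducts C] (T : C) (ι : Type) [Finite ι] :
    AddRetract T (⨁ fun _ : ι => T) :=
  biproduct fun _ => refl T

theorem biprod [HasBinaryBiproducts C] {T X Y : C} (hX : AddRetract T X) (hY : AddRetract T Y) :
    AddRetract T (X ⊞ Y) := by
  obtain ⟨ι, _, a, b, hab⟩ := hX
  obtain ⟨κ, _, c, d, hcd⟩ := hY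
  refine ⟨ι ⊕ κ, inferInstance, Sum.elim (fun i => biprod.fst ≫ a i) (fun j => biprod.snd ≫ c j),
    Sum.elim (fun i => b i ≫ biprod.inl) (fun j => d j ≫ biprod.inr), ?_⟩
  have h1 : ∑ i, (biprod.fst ≫ a i) ≫ b i ≫ biprod.inl
      = (biprod.fst : X ⊞ Y ⟶ X) ≫ (∑ i, a i ≫ b i) ≫ (biprod.inl : X ⟶ X ⊞ Y) := by
    simp [Preadditive.sum_comp, Preadditive.comp_sum]
  have h2 : ∑ i, (biprod.snd ≫ c i) ≫ d i ≫ biprod.inr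
      = (biprod.snd : X ⊞ Y ⟶ Y) ≫ (∑ i, c i ≫ d i) ≫ (biprod.inr : Y ⟶ X ⊞ Y) := by
    simp [Preadditive.sum_comp, Preadditive.comp_sum]
  rw [Fintype.sum_sum_type]
  simp only [Sum.elim_inl, Sum.elim_inr]
  rw [h1, h2, hab, hcd, Category.id_comp, Category.id_comp, biprod.total]

theorem exists_retract [HasFiniteBiproducts C] {T X : C} (h : AddRetract T X) :
    ∃ (n : ℕ) (i : X ⟶ ⨁ fun _ : Fin n => T) (r : (⨁ fun _ : Fin n => T) ⟶ X), i ≫ r = 𝟙 X := by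
  obtain ⟨ι, _, a, b, hab⟩ := h
  let e := Fintype.equivFin ι
  refine ⟨Fintype.card ι, biproduct.lift fun j => a (e.symm j),
    biproduct.desc fun j => b (e.symm j), ?_⟩
  rw [biproduct.lift_desc, ← hab]
  exact Equiv.sum_comp e.symm fun i => a i ≫ b i

theorem projective {T X : C} (h : AddRetract T X) [Projective T] : Projective X := by
  obtain ⟨ι, _, a, b, hab⟩ := h
  refine ⟨fun {E Y} f e _ => ⟨∑ i, a i ≫ Projective.factorThru (b i ≫ f) e, ?_⟩⟩
  calc (∑ i, a i ≫ Projective.factorThru (b i ≫ f) e) ≫ e = (∑ i, a i ≫ b i) ≫ f := by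
        simp [Preadditive.sum_comp]
    _ = f := by rw [hab, Category.id_comp]

theorem injective {T X : C} (h : AddRetract T X) [Injective T] : Injective X := by
  obtain ⟨ι, _, a, b, hab⟩ := h
  refine ⟨fun {Y E} f e _ => ⟨∑ i, Injective.factorThru (f ≫ a i) e ≫ b i, ?_⟩⟩
  calc e ≫ (∑ i, Injective.factorThru (f ≫ a i) e ≫ b i) = f ≫ (∑ i, a i ≫ b i) := by
        simp [Preadditive.comp_sum]
    _ = f := by rw [hab, Category.comp_id]

end AddRetract

/-- An orthogonal decomposition of the identity of `X` identifies `X` with a direct sum. -/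
def isoBiproductOfTotal [HasFiniteBiproducts C] {ι : Type} [Fintype ι] [DecidableEq ι] {X : C}
    {Y : ι → C} (a : ∀ i, X ⟶ Y i) (b : ∀ i, Y i ⟶ X) (h : ∀ i, b i ≫ a i = 𝟙 _)
    (h' : ∀ i j, i ≠ j → b i ≫ a j = 0) (total : ∑ i, a i ≫ b i = 𝟙 X) : X ≅ ⨁ Y where
  hom := biproduct.lift a
  inv := biproduct.desc b
  hom_inv_id := by rw [biproduct.lift_desc, total]
  inv_hom_id := by
    ext i j
    by_cases hij : i = j
    · subst hij; simp [h]
    · simp [h' j i (Ne.symm hij), biproduct.ι_π_ne _ (Ne.symm hij)]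

theorem exists_iso_biproduct_biprod [HasFiniteBiproducts C] [HasBinaryBiproducts C]
    {p : C → Prop} {X X' : C}
    (h : ∃ (n : ℕ) (Y : Fin n → C), (∀ i, p (Y i)) ∧ Nonempty (X ≅ ⨁ Y))
    (h' : ∃ (n : ℕ) (Y : Fin n → C), (∀ i, p (Y i)) ∧ Nonempty (X' ≅ ⨁ Y)) :
    ∃ (n : ℕ) (Y : Fin n → C), (∀ i, p (Y i)) ∧ Nonempty (X ⊞ X' ≅ ⨁ Y) := by
  obtain ⟨n, Y, hY, ⟨e⟩⟩ := h
  obtain ⟨m, Z, hZ, ⟨f⟩⟩ := h'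
  let W : Fin n ⊕ Fin m → C := Sum.elim Y Z
  have key : Nonempty ((⨁ Y) ⊞ (⨁ Z) ≅ ⨁ W) := by
    refine ⟨isoBiproductOfTotal
      (Sum.rec (fun i => biprod.fst ≫ biproduct.π Y i) (fun i => biprod.snd ≫ biproduct.π Z i))
      (Sum.rec (fun i => biproduct.ι Y i ≫ biprod.inl) (fun i => biproduct.ι Z i ≫ biprod.inr))
      ?_ ?_ ?_⟩
    · rintro (i | i) <;> simp [W]
    · rintro (i | i) (j | j) hij
      · have : i ≠ j := fun h => hij (by rw [h])
        simp [biproduct.ι_π_ne _ this, W]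
        rfl
      · simp [W]
        rfl
      · simp [W]
        rfl
      · have : i ≠ j := fun h => hij (by rw [h])
        simp [biproduct.ι_π_ne _ this, W]
        rfl
    · rw [Fintype.sum_sum_type]
      have h1 : ∑ i, (biprod.fst ≫ biproduct.π Y i) ≫ biproduct.ι Y i ≫ biprod.inl
          = (biprod.fst : (⨁ Y) ⊞ (⨁ Z) ⟶ _) ≫ (∑ i, biproduct.π Y i ≫ biproduct.ι Y i) ≫
            (biprod.inl : _ ⟶ (⨁ Y) ⊞ (⨁ Z)) := by
        simp only [Preadditive.sum_comp, Preadditive.comp_sum, Category.assoc]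
      have h2 : ∑ i, (biprod.snd ≫ biproduct.π Z i) ≫ biproduct.ι Z i ≫ biprod.inr
          = (biprod.snd : (⨁ Y) ⊞ (⨁ Z) ⟶ _) ≫ (∑ i, biproduct.π Z i ≫ biproduct.ι Z i) ≫
            (biprod.inr : _ ⟶ (⨁ Y) ⊞ (⨁ Z)) := by
        simp only [Preadditive.sum_comp, Preadditive.comp_sum, Category.assoc]
      refine (congrArg₂ (· + ·) h1 h2).trans ?_
      rw [biproduct.total, biproduct.total, Category.id_comp, Category.id_comp, biprod.total]
  obtain ⟨k⟩ := key
  refine ⟨n + m, W ∘ finSumFinEquiv.symm, fun i => ?_, ⟨biprod.mapIso e f ≪≫ k ≪≫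
    biproduct.whiskerEquiv finSumFinEquiv fun j => eqToIso (by simp)⟩⟩
  rcases h : finSumFinEquiv.symm i with j | j
  · simpa [W, h] using hY j
  · simpa [W, h] using hZ j

end Preadditive

/-! ### Finite-length modules: Fitting's lemma and Krull–Schmidt decompositions. -/

section Modules

variable {R : Type u} [Ring R]

theorem finite_of_epi {X Y : ModuleCat.{u} R} (f : X ⟶ Y) [Epi f] [Module.Finite R X] :
    Module.Finite R Y :=
  Module.Finite.of_surjective f.hom ((ModuleCat.epi_iff_surjective f).1 inferInstance)

theorem finite_of_mono [IsNoetherianRing R] {X Y : ModuleCat.{u} R} (f : X ⟶ Y) [Mono f]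
    [Module.Finite R Y] : Module.Finite R X :=
  Module.Finite.of_injective f.hom ((ModuleCat.mono_iff_injective f).1 inferInstance)

theorem finite_of_iso {X Y : ModuleCat.{u} R} (e : X ≅ Y) [Module.Finite R X] :
    Module.Finite R Y :=
  finite_of_epi e.hom

instance finite_biprod (X Y : ModuleCat.{u} R) [Module.Finite R X] [Module.Finite R Y] :
    Module.Finite R (X ⊞ Y : ModuleCat.{u} R) :=
  Module.Finite.equiv (ModuleCat.biprodIsoProd X Y).symm.toLinearEquiv

instance finite_biproduct {ι : Type} [Finite ι] (X : ι → ModuleCat.{u} R)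
    [∀ i, Module.Finite R (X i)] : Module.Finite R (⨁ X : ModuleCat.{u} R) :=
  Module.Finite.equiv (ModuleCat.biproductIsoPi X).symm.toLinearEquiv

theorem AddRetract.finite {T X : ModuleCat.{u} R} (h : AddRetract T X) [Module.Finite R T] :
    Module.Finite R X := by
  obtain ⟨n, i, r, w⟩ := h.exists_retract
  have : Epi (i ≫ r) := by rw [w]; infer_instance
  have : Epi r := epi_of_epi i r
  exact finite_of_epi r

theorem exists_biprod_of_retract {X Y : ModuleCat.{u} R} (i : Y ⟶ X) (r : X ⟶ Y)
    (w : i ≫ r = 𝟙 Y) : ∃ Z : ModuleCat.{u} R, Nonempty (X ≅ Y ⊞ Z) := by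
  have : Mono i := mono_of_mono_fac w
  exact ⟨cokernel i, ⟨(ShortComplex.Splitting.ofExactOfRetraction
    (ShortComplex.mk i (cokernel.π i) (cokernel.condition i))
    (ShortComplex.exact_cokernel i) r w inferInstance).isoBinaryBiproduct⟩⟩

/-- An indecomposable retract of an indecomposable is isomorphic
to it. -/
theorem nonempty_iso_of_indecomposable_of_retract {X Y : ModuleCat.{u} R} (hX : Indecomposable X)
    (hY : Indecomposable Y) (s : X ⟶ Y) (r : Y ⟶ X) (w : s ≫ r = 𝟙 X) : Nonempty (X ≅ Y) := by
  obtain ⟨Z, ⟨e⟩⟩ := exists_biprod_of_retract s r w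
  have hZ := (hY.2 _ _ e).resolve_left hX.1
  exact ⟨(isoBiprodZero hZ) ≪≫ e.symm⟩

section FiniteLength

variable [IsNoetherianRing R] [IsArtinianRing R]

/-- Induction principle: finitely generated modules are built from indecomposable ones by
binary direct sums. -/
theorem indecomposable_induction {P : ModuleCat.{u} R → Prop}
    (iso : ∀ {X Y : ModuleCat.{u} R}, (X ≅ Y) → P X → P Y)
    (zero : ∀ X : ModuleCat.{u} R, IsZero X → P X)
    (indec : ∀ X : ModuleCat.{u} R, Module.Finite R X → Indecomposable X → P X)
    (sum : ∀ X Y : ModuleCat.{u} R, P X → P Y → P (X ⊞ Y))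
    (X : ModuleCat.{u} R) [hX : Module.Finite R X] : P X := by
  have key : ∀ (m : ℕ∞) (X : ModuleCat.{u} R), Module.Finite R X → Module.length R X = m →
      P X := by
    intro m
    induction m using WellFoundedLT.induction with
    | ind m ih =>
      intro X hX hm
      by_cases h0 : IsZero X
      · exact zero X h0
      by_cases hi : Indecomposable X
      · exact indec X hX hi
      · simp only [Indecomposable, not_and, not_forall, not_or] at hi
        obtain ⟨Y, Z, e', hY, hZ⟩ := hi h0
        let e := e'.symm
        have : Module.Finite R (Y ⊞ Z : ModuleCat.{u} R) := finite_of_iso e.symm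
        have fY : Module.Finite R Y := finite_of_epi (biprod.fst : Y ⊞ Z ⟶ Y)
        have fZ : Module.Finite R Z := finite_of_epi (biprod.snd : Y ⊞ Z ⟶ Z)
        have hl : Module.length R X = Module.length R Y + Module.length R Z := by
          rw [← Module.length_prod]
          exact (e.symm ≪≫ ModuleCat.biprodIsoProd Y Z).toLinearEquiv.length_eq
        have nY : Module.length R Y ≠ 0 := fun h => hY
          (@ModuleCat.isZero_of_subsingleton _ _ _ (Module.length_eq_zero_iff.1 h))
        have nZ : Module.length R Z ≠ 0 := fun h => hZ
          (@ModuleCat.isZero_of_subsingleton _ _ _ (Module.length_eq_zero_iff.1 h))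
        have tY : Module.length R Y ≠ ⊤ := Module.length_ne_top
        have tZ : Module.length R Z ≠ ⊤ := Module.length_ne_top
        lift Module.length R Y to ℕ using tY with y hy
        lift Module.length R Z to ℕ using tZ with z hz
        -- Lengths are finite and both summands are nonzero, so each is strictly shorter than their
        -- sum.
        rw [hl] at hm
        subst hm
        norm_cast at nY nZ
        refine iso e (sum Y Z (ih y ?_ Y fY hy.symm) (ih z ?_ Z fZ hz.symm))
        · norm_cast; omega
        · norm_cast; omega
  exact key _ X hX rfl

theorem exists_iso_biproduct_indecomposable (X : ModuleCat.{u} R) [Module.Finite R X] :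
    ∃ (n : ℕ) (Y : Fin n → ModuleCat.{u} R),
      (∀ i, Module.Finite R (Y i) ∧ Indecomposable (Y i)) ∧ Nonempty (X ≅ ⨁ Y) := by
  refine indecomposable_induction (P := fun X => ∃ (n : ℕ) (Y : Fin n → ModuleCat.{u} R),
    (∀ i, Module.Finite R (Y i) ∧ Indecomposable (Y i)) ∧ Nonempty (X ≅ ⨁ Y)) ?_ ?_ ?_ ?_ X
  · rintro X X' e ⟨n, Y, hY, ⟨f⟩⟩
    exact ⟨n, Y, hY, ⟨e.symm ≪≫ f⟩⟩
  · intro X hX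
    refine ⟨0, Fin.elim0, fun i => i.elim0, ⟨hX.iso ?_⟩⟩
    rw [IsZero.iff_id_eq_zero, ← biproduct.total]
    simp
  · intro X h h'
    exact ⟨1, fun _ => X, fun _ => ⟨h, h'⟩, ⟨(biproductUniqueIso fun _ : Fin 1 => X).symm⟩⟩
  · intro X Y h h'
    exact exists_iso_biproduct_biprod
      (p := fun Y : ModuleCat.{u} R => Module.Finite R Y ∧ Indecomposable Y) h h'

/-- Fitting's lemma. -/
theorem isUnit_or_isNilpotent_of_indecomposable {X : ModuleCat.{u} R} [Module.Finite R X]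
    (hX : Indecomposable X) (f : Module.End R X) : IsUnit f ∨ IsNilpotent f := by
  -- Positivity of `n` is needed to pass from `f ^ n` being a unit to `f` being one.
  obtain ⟨n, hn⟩ := (f.eventually_isCompl_ker_pow_range_pow.and
    (Filter.eventually_gt_atTop 0)).exists
  obtain ⟨hc, hpos⟩ := hn
  have e : ModuleCat.of R (LinearMap.ker (f ^ n)) ⊞ ModuleCat.of R (LinearMap.range (f ^ n)) ≅ X :=
    ModuleCat.biprodIsoProd _ _ ≪≫ (Submodule.prodEquivOfIsCompl _ _ hc).toModuleIso
  rcases hX.2 _ _ e.symm with h | h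
  · left
    have hk : LinearMap.ker (f ^ n) = ⊥ :=
      (Submodule.subsingleton_iff_eq_bot).1 (ModuleCat.subsingleton_of_isZero h)
    have hr : LinearMap.range (f ^ n) = ⊤ := by
      have := hc.sup_eq_top
      rwa [hk, bot_sup_eq] at this
    have : IsUnit (f ^ n) := (Module.End.isUnit_iff _).2
      ⟨LinearMap.ker_eq_bot.1 hk, LinearMap.range_eq_top.1 hr⟩
    exact (isUnit_pow_iff hpos.ne').1 this
  · right
    refine ⟨n, LinearMap.range_eq_bot.1 ?_⟩
    exact (Submodule.subsingleton_iff_eq_bot).1 (ModuleCat.subsingleton_of_isZero h)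

/-- By Fitting's lemma the endomorphism ring is local, so a sum of non-units is never the identity.
-/
theorem exists_isIso_of_sum_eq_id {X : ModuleCat.{u} R} [Module.Finite R X]
    (hX : Indecomposable X) {ι : Type} [Fintype ι] (f : ι → (X ⟶ X)) (hf : ∑ i, f i = 𝟙 X) :
    ∃ i, IsIso (f i) := by
  classical
  by_contra! hcon
  have hn : ∀ i, ¬ IsUnit (f i).hom := by
    intro i hi
    apply hcon i
    have := (Module.End.isUnit_iff _).1 hi
    rwa [ConcreteCategory.isIso_iff_bijective]
  have hnt : Nontrivial (Module.End R X) := by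
    by_contra h
    rw [not_nontrivial_iff_subsingleton] at h
    apply hX.1
    rw [IsZero.iff_id_eq_zero]
    exact ModuleCat.hom_ext (Subsingleton.elim _ _)
  have key : ∀ s : Finset ι, ¬ IsUnit (∑ i ∈ s, (f i).hom) := by
    intro s
    induction s using Finset.induction_on with
    | empty => simp
    | insert i s his ih =>
      rw [Finset.sum_insert his]
      rintro ⟨u, hu⟩
      -- After normalising the sum to `1`, the first term is a non-unit, hence nilpotent, so the
      -- second is `1` minus a nilpotent and therefore a unit.
      have h1 : (↑u⁻¹ * (f i).hom : Module.End R X) + ↑u⁻¹ * ∑ j ∈ s, (f j).hom = 1 := by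
        rw [← mul_add, ← hu, Units.inv_mul]
      have h2 : ¬ IsUnit (↑u⁻¹ * (f i).hom : Module.End R X) := by
        rw [Units.isUnit_units_mul]; exact hn i
      have h3 := (isUnit_or_isNilpotent_of_indecomposable hX _).resolve_left h2
      have h4 := h3.isUnit_one_sub
      rw [← h1, add_sub_cancel_left, Units.isUnit_units_mul] at h4
      exact ih h4
  apply key Finset.univ
  have : ∑ i, (f i).hom = (∑ i, f i).hom := by simp
  rw [this, hf]
  exact isUnit_one

theorem exists_retract_of_indecomposable {X : ModuleCat.{u} R} [Module.Finite R X]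
    (hX : Indecomposable X) {ι : Type} [Fintype ι] {Z : ι → ModuleCat.{u} R}
    (a : ∀ i, X ⟶ Z i) (b : ∀ i, Z i ⟶ X) (h : ∑ i, a i ≫ b i = 𝟙 X) :
    ∃ (i : ι) (s : X ⟶ Z i) (r : Z i ⟶ X), s ≫ r = 𝟙 X := by
  obtain ⟨i, hi⟩ := exists_isIso_of_sum_eq_id hX _ h
  exact ⟨i, a i, b i ≫ inv (a i ≫ b i), by rw [← Category.assoc, IsIso.hom_inv_id]⟩

/-- Each indecomposable component of `X` is a retract of a power of `T`; locality of its
endomorphism ring makes it a retract of a single copy. This reconciles `AddRetract` with the literal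
definition of `add T`. -/
theorem exists_iso_biproduct_summand {T X : ModuleCat.{u} R} [Module.Finite R T]
    (h : AddRetract T X) : ∃ (n : ℕ) (Y : Fin n → ModuleCat.{u} R),
      (∀ i, ∃ Z : ModuleCat.{u} R, Nonempty (T ≅ Y i ⊞ Z)) ∧ Nonempty (X ≅ ⨁ Y) := by
  have := h.finite
  obtain ⟨n, Y, hY, ⟨e⟩⟩ := exists_iso_biproduct_indecomposable X
  refine ⟨n, Y, fun i => ?_, ⟨e⟩⟩
  obtain ⟨ι, _, a, b, hab⟩ := (h.of_iso e).of_retract (biproduct.ι Y i) (biproduct.π Y i) (by simp)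
  have := (hY i).1
  obtain ⟨_, s, r, w⟩ := exists_retract_of_indecomposable (hY i).2 a b hab
  exact exists_biprod_of_retract s r w

end FiniteLength

end Modules

section RightModules

variable {Λ : Type u} [Ring Λ]

theorem InAdd.addRetract {T X : RightMod Λ} (h : InAdd T X) : AddRetract T X := by
  obtain ⟨n, Y, hY, ⟨e⟩⟩ := h
  refine (AddRetract.biproduct fun i => ?_).of_iso e.symm
  obtain ⟨Z, ⟨f⟩⟩ := hY i
  exact (AddRetract.refl T).of_retract (biprod.inl ≫ f.inv) (f.hom ≫ biprod.fst) (by simp)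

theorem inAdd_iff [IsNoetherianRing Λᵐᵒᵖ] [IsArtinianRing Λᵐᵒᵖ] {T X : RightMod Λ}
    (hT : IsFG T) : InAdd T X ↔ AddRetract T X :=
  ⟨InAdd.addRetract, fun h => by
    have : Module.Finite Λᵐᵒᵖ T := hT
    exact exists_iso_biproduct_summand h⟩

end RightModules

/-! ### Long exact sequences of Ext: vanishing, lifting and extension. -/

section Abelian

variable {C : Type u} [Category.{v} C] [Abelian C]

theorem shortExact_kernel {X Y : C} (f : X ⟶ Y) [Epi f] :
    (ShortComplex.mk (kernel.ι f) f (kernel.condition f)).ShortExact where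
  exact := ShortComplex.exact_kernel f
  mono_f := inferInstanceAs (Mono (kernel.ι f))
  epi_g := ‹Epi f›

theorem shortExact_cokernel {X Y : C} (f : X ⟶ Y) [Mono f] :
    (ShortComplex.mk f (cokernel.π f) (cokernel.condition f)).ShortExact where
  exact := ShortComplex.exact_cokernel f
  mono_f := ‹Mono f›
  epi_g := inferInstanceAs (Epi (cokernel.π f))

variable [HasExt.{w} C]

open CategoryTheory.Abelian

theorem AddRetract.subsingleton_ext_left {T X Y : C} (h : AddRetract T X) {n : ℕ}
    (hT : Subsingleton (Ext T Y n)) : Subsingleton (Ext X Y n) := by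
  obtain ⟨ι, _, a, b, hab⟩ := h
  refine subsingleton_of_forall_eq 0 fun x => ?_
  rw [← Ext.mk₀_id_comp x, ← hab]
  have : Ext.mk₀ (∑ i, a i ≫ b i) = ∑ i, Ext.mk₀ (a i ≫ b i) :=
    map_sum (Ext.addEquiv₀ (X := X) (Y := X)).symm _ _
  rw [this, Ext.sum_comp]
  refine Finset.sum_eq_zero fun i _ => ?_
  rw [← Ext.mk₀_comp_mk₀_assoc, Subsingleton.elim ((Ext.mk₀ (b i)).comp x _) 0, Ext.comp_zero]

theorem AddRetract.subsingleton_ext_right {T X Y : C} (h : AddRetract T X) {n : ℕ}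
    (hT : Subsingleton (Ext Y T n)) : Subsingleton (Ext Y X n) := by
  obtain ⟨ι, _, a, b, hab⟩ := h
  refine subsingleton_of_forall_eq 0 fun x => ?_
  rw [← Ext.comp_mk₀_id x, ← hab]
  have : Ext.mk₀ (∑ i, a i ≫ b i) = ∑ i, Ext.mk₀ (a i ≫ b i) :=
    map_sum (Ext.addEquiv₀ (X := X) (Y := X)).symm _ _
  rw [this, Ext.comp_sum]
  refine Finset.sum_eq_zero fun i _ => ?_
  rw [← Ext.mk₀_comp_mk₀, ← Ext.comp_assoc_of_third_deg_zero,
    Subsingleton.elim (x.comp (Ext.mk₀ (a i)) _) 0, Ext.zero_comp]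

variable {S : ShortComplex C} (hS : S.ShortExact)
include hS

theorem subsingleton_ext_X₃ (X : C) {n : ℕ} (h₂ : Subsingleton (Ext X S.X₂ n))
    (h₁ : Subsingleton (Ext X S.X₁ (n + 1))) : Subsingleton (Ext X S.X₃ n) := by
  refine subsingleton_of_forall_eq 0 fun x => ?_
  obtain ⟨y, rfl⟩ := Ext.covariant_sequence_exact₃ X hS x rfl (Subsingleton.elim _ _)
  rw [Subsingleton.elim y 0, Ext.zero_comp]

theorem subsingleton_ext_X₁_left (Y : C) {n : ℕ} (h₂ : Subsingleton (Ext S.X₂ Y n))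
    (h₃ : Subsingleton (Ext S.X₃ Y (n + 1))) : Subsingleton (Ext S.X₁ Y n) := by
  refine subsingleton_of_forall_eq 0 fun x => ?_
  obtain ⟨y, rfl⟩ := Ext.contravariant_sequence_exact₁ hS Y x (add_comm 1 n)
    (Subsingleton.elim _ _)
  rw [Subsingleton.elim y 0, Ext.comp_zero]

theorem exists_lift_of_subsingleton_ext {X : C} (h : Subsingleton (Ext X S.X₁ 1)) (f : X ⟶ S.X₃) :
    ∃ g : X ⟶ S.X₂, g ≫ S.g = f := by
  obtain ⟨y, hy⟩ := Ext.covariant_sequence_exact₃ X hS (Ext.mk₀ f) (zero_add 1)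
    (Subsingleton.elim _ _)
  obtain ⟨g, rfl⟩ := (Ext.mk₀_bijective X S.X₂).2 y
  rw [Ext.mk₀_comp_mk₀] at hy
  exact ⟨g, (Ext.mk₀_bijective _ _).1 hy⟩

theorem exists_extension_of_subsingleton_ext {Y : C} (h : Subsingleton (Ext S.X₃ Y 1))
    (f : S.X₁ ⟶ Y) : ∃ g : S.X₂ ⟶ Y, S.f ≫ g = f := by
  obtain ⟨y, hy⟩ := Ext.contravariant_sequence_exact₁ hS Y (Ext.mk₀ f) (add_zero 1)
    (Subsingleton.elim _ _)
  obtain ⟨g, rfl⟩ := (Ext.mk₀_bijective S.X₂ Y).2 y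
  rw [Ext.mk₀_comp_mk₀] at hy
  exact ⟨g, (Ext.mk₀_bijective _ _).1 hy⟩

/-- Every class comes from some `X ⟶ S.X₃` under the connecting map, and the connecting map kills
whatever lifts to `S.X₂`. -/
theorem subsingleton_ext_X₁_of_lift {X : C} (h₂ : Subsingleton (Ext X S.X₂ 1))
    (h : ∀ f : X ⟶ S.X₃, ∃ g : X ⟶ S.X₂, g ≫ S.g = f) : Subsingleton (Ext X S.X₁ 1) := by
  refine subsingleton_of_forall_eq 0 fun x => ?_
  obtain ⟨y, rfl⟩ := Ext.covariant_sequence_exact₁ X hS x (Subsingleton.elim _ _) (zero_add 1)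
  obtain ⟨f, rfl⟩ := (Ext.mk₀_bijective _ _).2 y
  obtain ⟨g, rfl⟩ := h f
  rw [← Ext.mk₀_comp_mk₀, Ext.comp_assoc_of_second_deg_zero, hS.comp_extClass, Ext.comp_zero]

end Abelian

/-! ### The regular right module and the classes `Gen` and `Cogen`. -/

section RightModules

variable {Λ : Type u} [Ring Λ]

/-- The homomorphism `Λ_Λ → X` that sends `1` to `x`. -/
def regularHom {X : RightMod Λ} (x : X) : regular Λ ⟶ X :=
  ModuleCat.ofHom (X := Λ)
    { toFun := fun a => op a • x
      map_add' := fun a b => by rw [MulOpposite.op_add, add_smul]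
      map_smul' := fun r a => by
        change op (a * r.unop) • x = r • op a • x
        rw [op_mul, mul_smul, op_unop] }

theorem regularHom_apply_one {X : RightMod Λ} (x : X) :
    (regularHom x).hom (1 : Λ) = x := one_smul _ _

theorem regular_hom_ext {X : RightMod Λ} {f g : regular Λ ⟶ X}
    (h : f.hom (1 : Λ) = g.hom (1 : Λ)) : f = g := by
  refine ModuleCat.hom_ext (LinearMap.ext fun (a : Λ) => ?_)
  have ha : a = op a • (1 : Λ) := (one_mul a).symm
  have hf : f.hom a = op a • f.hom (1 : Λ) := by
    conv_lhs => rw [ha]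
    exact f.hom.map_smul (op a) (1 : Λ)
  have hg : g.hom a = op a • g.hom (1 : Λ) := by
    conv_lhs => rw [ha]
    exact g.hom.map_smul (op a) (1 : Λ)
  rw [hf, hg, h]

instance projective_regular : Projective (regular Λ) where
  factors {E X} f e _ := by
    obtain ⟨y, hy⟩ := (ModuleCat.epi_iff_surjective e).1 inferInstance (f.hom (1 : Λ))
    exact ⟨regularHom y, regular_hom_ext (by
      exact (congrArg e.hom (regularHom_apply_one y)).trans hy)⟩

instance finite_regular : Module.Finite Λᵐᵒᵖ (regular Λ) :=
  Module.Finite.of_surjective (LinearMap.toSpanSingleton Λᵐᵒᵖ Λ 1)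
    fun (a : Λ) => ⟨op a, one_mul a⟩

/-- A family of homomorphisms whose images contain a generating set is jointly epimorphic. -/
theorem epi_desc_of_mem_range {X : RightMod Λ} {n : ℕ} (x : Fin n → X)
    (hx : Submodule.span Λᵐᵒᵖ (Set.range x) = ⊤) {Y : Fin n → RightMod Λ} (f : ∀ i, Y i ⟶ X)
    (hf : ∀ i, x i ∈ LinearMap.range (f i).hom) : Epi (biproduct.desc f) := by
  rw [ModuleCat.epi_iff_range_eq_top, ← top_le_iff, ← hx, Submodule.span_le]
  rintro _ ⟨i, rfl⟩
  obtain ⟨y, hy⟩ := hf i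
  refine ⟨(biproduct.ι Y i).hom y, ?_⟩
  rw [← hy, ← LinearMap.comp_apply, ← ModuleCat.hom_comp, biproduct.ι_desc]

theorem exists_epi_of_generators (X : RightMod Λ) [Module.Finite Λᵐᵒᵖ X] (E : RightMod Λ)
    (h : ∀ x : X, ∃ f : E ⟶ X, x ∈ LinearMap.range f.hom) :
    ∃ (n : ℕ) (f : (⨁ fun _ : Fin n => E) ⟶ X), Epi f := by
  obtain ⟨n, x, hx⟩ := Module.Finite.exists_fin (R := Λᵐᵒᵖ) (M := X)
  choose f hf using h
  exact ⟨n, biproduct.desc fun i => f (x i), epi_desc_of_mem_range x hx _ fun i => hf _⟩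

theorem exists_epi_regular (X : RightMod Λ) [Module.Finite Λᵐᵒᵖ X] :
    ∃ (n : ℕ) (f : (⨁ fun _ : Fin n => regular Λ) ⟶ X), Epi f :=
  exists_epi_of_generators X _ fun x => ⟨regularHom x, (1 : Λ), regularHom_apply_one x⟩

theorem inGen_iff {T X : RightMod Λ} :
    InGen T X ↔ IsFG X ∧ ∃ E : RightMod Λ, AddRetract T E ∧ ∃ f : E ⟶ X, Epi f := by
  constructor
  · rintro ⟨h, d, f, hf⟩
    exact ⟨h, _, AddRetract.power T _, f, hf⟩
  · rintro ⟨h, E, hE, f, hf⟩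
    obtain ⟨n, i, r, w⟩ := hE.exists_retract
    have : Epi (i ≫ r) := by rw [w]; infer_instance
    have : Epi r := epi_of_epi i r
    exact ⟨h, n, r ≫ f, inferInstance⟩

theorem inCogen_of_addRetract {T X E : RightMod Λ} (h : IsFG X) (hE : AddRetract T E)
    (f : X ⟶ E) [Mono f] : InCogen T X := by
  obtain ⟨n, i, r, w⟩ := hE.exists_retract
  have : Mono i := mono_of_mono_fac w
  exact ⟨h, n, f ≫ i, inferInstance⟩

theorem InGen.trans {T E X : RightMod Λ} (h : InGen T E) (h' : InGen E X) : InGen T X := by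
  obtain ⟨_, m, g, hg⟩ := h
  obtain ⟨hX, n, f, hf⟩ := h'
  refine inGen_iff.2 ⟨hX, ⨁ fun _ : Fin n => ⨁ fun _ : Fin m => T,
    AddRetract.biproduct fun _ => AddRetract.power T _, (biproduct.map fun _ => g) ≫ f, ?_⟩
  infer_instance

theorem inGen_of_addRetract [IsNoetherianRing Λᵐᵒᵖ] {T X : RightMod Λ} (hT : IsFG T)
    (h : AddRetract T X) : InGen T X := by
  have : Module.Finite Λᵐᵒᵖ T := hT
  exact inGen_iff.2 ⟨h.finite, X, h, 𝟙 X, inferInstance⟩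

end RightModules

/-! ### Finite-dimensional algebras: chain conditions and finite-dimensional Hom spaces. -/

section Algebra

variable (k : Type u) [Field k] {Λ : Type u} [Ring Λ] [Algebra k Λ] [Module.Finite k Λ]

include k in
theorem isNoetherianRing_op : IsNoetherianRing Λᵐᵒᵖ :=
  isNoetherian_of_tower k inferInstance

include k in
theorem isArtinianRing_op : IsArtinianRing Λᵐᵒᵖ :=
  isArtinian_of_tower k inferInstance

/-- A homomorphism is determined by its values on finitely many generators, which embeds the Hom
space in a power of `X`. -/
theorem finite_hom (T X : RightMod Λ) [Module.Finite Λᵐᵒᵖ T] [Module.Finite Λᵐᵒᵖ X] :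
    Module.Finite k (T ⟶ X) := by
  obtain ⟨n, x, hx⟩ := Module.Finite.exists_fin (R := Λᵐᵒᵖ) (M := T)
  let := Module.compHom X (algebraMap k Λᵐᵒᵖ)
  have : IsScalarTower k Λᵐᵒᵖ X := ⟨fun a b x => by
    rw [Algebra.smul_def, mul_smul]; rfl⟩
  have : Module.Finite k X := Module.Finite.trans Λᵐᵒᵖ X
  let ev : (T ⟶ X) →ₗ[k] (Fin n → X) :=
    { toFun := fun f i => f.hom (x i)
      map_add' := fun f g => rfl
      map_smul' := fun c f => rfl }
  refine Module.Finite.of_injective ev fun f g h => ModuleCat.hom_ext ?_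
  refine LinearMap.ext_on_range hx fun i => congrFun h i

include k in
/-- Every homomorphism `T → X` factors through a fixed homomorphism from a power of `T`. -/
theorem exists_universal_hom (T X : RightMod Λ) [Module.Finite Λᵐᵒᵖ T] [Module.Finite Λᵐᵒᵖ X] :
    ∃ (n : ℕ) (p : (⨁ fun _ : Fin n => T) ⟶ X), ∀ f : T ⟶ X, ∃ g, g ≫ p = f := by
  have := finite_hom k T X
  obtain ⟨n, x, hx⟩ := Module.Finite.exists_fin (R := k) (M := T ⟶ X)
  refine ⟨n, biproduct.desc x, fun f => ?_⟩
  obtain ⟨c, hc⟩ := (Submodule.mem_span_range_iff_exists_fun k).1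
    (hx ▸ Submodule.mem_top : f ∈ Submodule.span k (Set.range x))
  refine ⟨biproduct.lift fun i => c i • 𝟙 T, ?_⟩
  rw [biproduct.lift_desc, ← hc]
  simp

end Algebra

/-! ### Tilting modules: the torsion class, its Ext-projectives and the hereditary property. -/

namespace IsTilting

open CategoryTheory.Abelian

variable {Λ : Type u} [Ring Λ] {T : RightMod Λ}

/-- Since `pd T ≤ 1` kills `Ext²(T, kernel f)`, the functor `Ext¹(T, -)` preserves this epimorphism.
-/
theorem ext_of_epi (hT : HasProjectiveDimensionLE T 1) {E X : RightMod Λ} (f : E ⟶ X) [Epi f]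
    (hE : Subsingleton (Ext T E 1)) : Subsingleton (Ext T X 1) :=
  subsingleton_ext_X₃ (shortExact_kernel f) T hE
    (HasProjectiveDimensionLT.subsingleton T 2 2 le_rfl _)

theorem ext_of_inGen (hT : IsTilting T) {X : RightMod Λ} (h : InGen T X) :
    Subsingleton (Ext T X 1) := by
  obtain ⟨_, E, hE, f, _⟩ := inGen_iff.1 h
  exact ext_of_epi hT.projDim_le_one f (hE.subsingleton_ext_right hT.ext_self)

/-- An element of `X` is a map `Λ → X`. It extends along `Λ → T₀` because `Ext¹(T₁, X) = 0`, so the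
element lies in the image of a map from `T₀`. -/
theorem inGen_of_ext (hT : IsTilting T) {X : RightMod Λ} (hX : IsFG X)
    (h : Subsingleton (Ext T X 1)) : InGen T X := by
  obtain ⟨T₀, T₁, h₀, h₁, f, g, w, hS⟩ := hT.coresolution
  have : Module.Finite Λᵐᵒᵖ X := hX
  obtain ⟨n, p, hp⟩ := exists_epi_of_generators X T₀ fun x => by
    obtain ⟨q, hq⟩ := exists_extension_of_subsingleton_ext hS
      (h₁.addRetract.subsingleton_ext_left h) (regularHom x)
    refine ⟨q, f.hom (1 : Λ), ?_⟩
    rw [← regularHom_apply_one x, ← hq]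
    rfl
  exact inGen_iff.2 ⟨hX, _, h₀.addRetract.trans (AddRetract.power _ _), p, hp⟩

theorem inGen_of_injective (hT : IsTilting T) {X : RightMod Λ} (hX : IsFG X) [Injective X] :
    InGen T X :=
  hT.inGen_of_ext hX (Ext.subsingleton_of_injective T X 0)

/-- Projectivity embeds `Q` in a power of `Λ`, hence in a power of `T₀`; injectivity splits the
embedding. -/
theorem addRetract_of_projective_injective (hT : IsTilting T) {Q : RightMod Λ} (hQ : IsFG Q)
    [Projective Q] [Injective Q] : AddRetract T Q := by
  have : Module.Finite Λᵐᵒᵖ Q := hQ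
  obtain ⟨T₀, T₁, h₀, h₁, f, g, w, hS⟩ := hT.coresolution
  have : Mono f := hS.mono_f
  obtain ⟨n, p, hp⟩ := exists_epi_regular Q
  let s := Projective.factorThru (𝟙 Q) p
  have hs : s ≫ p = 𝟙 Q := Projective.factorThru_comp _ _
  have : Mono s := mono_of_mono_fac hs
  let i := s ≫ biproduct.map fun _ : Fin n => f
  exact (h₀.addRetract.trans (AddRetract.power T₀ (Fin n))).of_retract i
    (Injective.factorThru (𝟙 Q) i) (Injective.comp_factorThru _ _)

variable (k : Type u) [Field k] [Algebra k Λ] [Module.Finite k Λ]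

include k in
-- The universal map `p` from a power of `T` is onto. Since every `T ⟶ X` lifts through `p` and
-- `Ext¹(T, T) = 0`, also `Ext¹(T, kernel p) = 0`, which puts the kernel in `Gen T`.
theorem exists_approximation (hT : IsTilting T) {X : RightMod Λ} (h : InGen T X) :
    ∃ K E : RightMod Λ, InGen T K ∧ AddRetract T E ∧ HasSES K E X := by
  have : Module.Finite Λᵐᵒᵖ X := h.1
  have : Module.Finite Λᵐᵒᵖ T := hT.fg
  have := isNoetherianRing_op k (Λ := Λ)
  obtain ⟨n, p, hp⟩ := exists_universal_hom k T X
  have hepi : Epi p := by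
    obtain ⟨_, d, f, _⟩ := h
    choose g hg using fun i : Fin d => hp (biproduct.ι (fun _ : Fin d => T) i ≫ f)
    have : biproduct.desc g ≫ p = f := by
      refine biproduct.hom_ext' _ _ fun i => ?_
      rw [biproduct.ι_desc_assoc, hg]
    have : Epi (biproduct.desc g ≫ p) := by rw [this]; infer_instance
    exact epi_of_epi (biproduct.desc g) p
  have hS := shortExact_kernel p
  refine ⟨kernel p, _, hT.inGen_of_ext (finite_of_mono (kernel.ι p)) ?_, AddRetract.power T (Fin n),
    _, _, _, hS⟩
  exact subsingleton_ext_X₁_of_lift hS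
    ((AddRetract.power T _).subsingleton_ext_right hT.ext_self) hp

include k in
-- The approximation sequence of an Ext-projective of `Gen T` splits, because its kernel is in `Gen
-- T`. Thus `Gen T` determines `add T`.
theorem addRetract_of_ext (hT : IsTilting T) {X : RightMod Λ} (h : InGen T X)
    (hX : ∀ Y : RightMod Λ, InGen T Y → Subsingleton (Ext X Y 1)) : AddRetract T X := by
  obtain ⟨K, E, hK, hE, f, g, w, hS⟩ := hT.exists_approximation k h
  obtain ⟨s, hs⟩ := exists_lift_of_subsingleton_ext hS (hX K hK) (𝟙 X)
  exact hE.of_retract s g hs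

include k in
theorem addRetract_of_inGen_iff (hT : IsTilting T) {T' : RightMod Λ} (hT' : IsTilting T')
    (h : ∀ X : RightMod Λ, InGen T X ↔ InGen T' X) : AddRetract T T' := by
  have := isNoetherianRing_op k (Λ := Λ)
  exact hT.addRetract_of_ext k ((h _).2 (inGen_of_addRetract hT'.fg (AddRetract.refl T')))
    fun Y hY => hT'.ext_of_inGen ((h Y).1 hY)

include k in
theorem inAdd_iff_of_inGen_iff (hT : IsTilting T) {T' : RightMod Λ} (hT' : IsTilting T')
    (h : ∀ X : RightMod Λ, InGen T X ↔ InGen T' X) (X : RightMod Λ) : InAdd T' X ↔ InAdd T X := by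
  have := isNoetherianRing_op k (Λ := Λ)
  have := isArtinianRing_op k (Λ := Λ)
  rw [inAdd_iff hT.fg, inAdd_iff hT'.fg]
  exact ⟨(hT.addRetract_of_inGen_iff k hT' h).trans,
    (hT'.addRetract_of_inGen_iff k hT fun X => (h X).symm).trans⟩

include k in
theorem hasHereditaryProperty (hT : IsTilting T) (hid : HasInjectiveDimensionLE T 1)
    (hgl : ∀ X : RightMod Λ, IsFG X → HasProjectiveDimensionLE X 2) :
    HasHereditaryProperty T := by
  intro M hM
  have := isNoetherianRing_op k (Λ := Λ)
  have := isArtinianRing_op k (Λ := Λ)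
  obtain ⟨K, E, hK, hE, f, g, w, hS⟩ := hT.exists_approximation k hM
  have hM2 : HasProjectiveDimensionLE M 2 := hgl M hM.1
  -- `Ext¹(K, N)` sits between `Ext¹(E, N) = 0` and `Ext²(M, N)`, so it remains to kill the latter.
  refine ⟨K, E, (inAdd_iff hT.fg).2 (hT.addRetract_of_ext k hK fun N hN => ?_),
    (inAdd_iff hT.fg).2 hE, f, g, w, hS⟩
  obtain ⟨_, F, hF, p, _⟩ := inGen_iff.1 hN
  -- `N` is a quotient of `F` in `add T`: `id T ≤ 1` gives `Ext²(M, F) = 0`, and `pd M ≤ 2` kills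
  -- `Ext³` into the kernel.
  have h2 : Subsingleton (Ext M N 2) :=
    subsingleton_ext_X₃ (shortExact_kernel p) M
      (hF.subsingleton_ext_right (HasInjectiveDimensionLT.subsingleton T 2 2 le_rfl M))
      (HasProjectiveDimensionLT.subsingleton M 3 3 le_rfl _)
  exact subsingleton_ext_X₁_left hS N (hE.subsingleton_ext_left (hT.ext_of_inGen hN)) h2

end IsTilting

/-! ### Injectivity tests and finite sums of projectives or injectives. -/

section InjectiveModules

open CategoryTheory.Abelian

variable {R : Type u} [Ring R]

/-- Baer's criterion in terms of `Ext`. -/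
theorem injective_of_subsingleton_ext {J : ModuleCat.{u} R}
    (h : ∀ X : ModuleCat.{u} R, Module.Finite R X → Subsingleton (Ext X J 1)) : Injective J := by
  rw [← Module.injective_iff_injective_object]
  refine Module.Baer.injective fun I g => ?_
  let i : ModuleCat.of R I ⟶ ModuleCat.of R R := ModuleCat.ofHom I.subtype
  have : Mono i := (ModuleCat.mono_iff_injective i).2 I.injective_subtype
  have : Module.Finite R (ModuleCat.of R R) := inferInstanceAs (Module.Finite R R)
  -- Only the cyclic modules `R / I` are tested, so a vanishing hypothesis on finitely generated
  -- modules suffices.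
  have hfin : Module.Finite R (cokernel i : ModuleCat.{u} R) := finite_of_epi (cokernel.π i)
  obtain ⟨q, hq⟩ := exists_extension_of_subsingleton_ext (shortExact_cokernel i) (h _ hfin)
    (ModuleCat.ofHom g)
  refine ⟨q.hom, fun x hx => ?_⟩
  exact congrArg (fun f : ModuleCat.of R I ⟶ J => f.hom ⟨x, hx⟩) hq

theorem projective_biproduct {ι : Type} [Finite ι] {P : ι → ModuleCat.{u} R}
    (h : ∀ i, Projective (P i)) : Projective (⨁ P) := by
  refine ⟨fun {E X} f e _ => ⟨biproduct.desc fun i =>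
    Projective.factorThru (biproduct.ι P i ≫ f) e, ?_⟩⟩
  refine biproduct.hom_ext' _ _ fun i => ?_
  rw [biproduct.ι_desc_assoc, Projective.factorThru_comp]

theorem injective_biproduct {ι : Type} [Finite ι] {P : ι → ModuleCat.{u} R}
    (h : ∀ i, Injective (P i)) : Injective (⨁ P) := by
  refine ⟨fun {X E} f e _ => ⟨biproduct.lift fun i =>
    Injective.factorThru (f ≫ biproduct.π P i) e, ?_⟩⟩
  refine biproduct.hom_ext _ _ fun i => ?_
  rw [Category.assoc, biproduct.lift_π, Injective.comp_factorThru]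

end InjectiveModules

/-! ### Projective-injective modules and the construction of the tilting module. -/

section ProjectiveInjective

variable {Λ : Type u} [Ring Λ]

namespace IsSumOfProjInj

variable {Q : RightMod Λ}

theorem isFG (hQ : IsSumOfProjInj Q) : IsFG Q := by
  obtain ⟨n, P, hP, ⟨e⟩⟩ := hQ
  have : ∀ i, Module.Finite Λᵐᵒᵖ (P i) := hP.fg
  exact finite_of_iso e.symm

theorem projective (hQ : IsSumOfProjInj Q) : Projective Q := by
  obtain ⟨n, P, hP, ⟨e⟩⟩ := hQ
  exact Projective.of_iso e.symm (projective_biproduct fun i => (hP.prop i).1)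

theorem injective (hQ : IsSumOfProjInj Q) : Injective Q := by
  obtain ⟨n, P, hP, ⟨e⟩⟩ := hQ
  exact Injective.of_iso e.symm (injective_biproduct fun i => (hP.prop i).2)

theorem addRetract [IsNoetherianRing Λᵐᵒᵖ] [IsArtinianRing Λᵐᵒᵖ] (hQ : IsSumOfProjInj Q)
    {X : RightMod Λ} (hX : IsFG X) [Projective X] [Injective X] : AddRetract Q X := by
  obtain ⟨n, P, hP, ⟨e⟩⟩ := hQ
  have : Module.Finite Λᵐᵒᵖ X := hX
  obtain ⟨m, Y, hY, ⟨f⟩⟩ := exists_iso_biproduct_indecomposable X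
  refine (AddRetract.biproduct fun i => ?_).of_iso f.symm
  have hr : AddRetract X (Y i) :=
    ((AddRetract.refl X).of_iso f).of_retract (biproduct.ι Y i) (biproduct.π Y i) (by simp)
  obtain ⟨j, ⟨g⟩⟩ := hP.complete (Y i) (hY i).1 (hY i).2 ⟨hr.projective, hr.injective⟩
  exact (AddRetract.refl Q).of_retract (g.hom ≫ biproduct.ι P j ≫ e.inv)
    (e.hom ≫ biproduct.π P j ≫ g.inv) (by simp)

end IsSumOfProjInj

theorem addRetract_regular {X : RightMod Λ} (hX : IsFG X) [Projective X] :
    AddRetract (regular Λ) X := by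
  have : Module.Finite Λᵐᵒᵖ X := hX
  obtain ⟨n, p, hp⟩ := exists_epi_regular X
  exact (AddRetract.power (regular Λ) (Fin n)).of_retract (Projective.factorThru (𝟙 X) p) p
    (Projective.factorThru_comp _ _)

theorem exists_isSumOfProjInj [IsNoetherianRing Λᵐᵒᵖ] [IsArtinianRing Λᵐᵒᵖ] :
    ∃ Q : RightMod Λ, IsSumOfProjInj Q := by
  classical
  obtain ⟨m, Y, hY, ⟨e⟩⟩ := exists_iso_biproduct_indecomposable (regular Λ)
  -- Every indecomposable finitely generated projective is a component of `Λ_Λ`, so the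
  -- representatives are the projective-injective components of one decomposition, modulo
  -- isomorphism.
  let S := {i : Fin m // Projective (Y i) ∧ Injective (Y i)}
  let r : Setoid S :=
    { r := fun i j => Nonempty (Y i.1 ≅ Y j.1)
      iseqv := ⟨fun _ => ⟨Iso.refl _⟩, fun ⟨f⟩ => ⟨f.symm⟩, fun ⟨f⟩ ⟨g⟩ => ⟨f ≪≫ g⟩⟩ }
  let ε := Fintype.equivFin (Quotient r)
  let P : Fin (Fintype.card (Quotient r)) → RightMod Λ := fun j => Y (ε.symm j).out.1
  refine ⟨⨁ P, _, P, ⟨fun i => (hY _).1, fun i => (hY _).2, fun i => (ε.symm i).out.2,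
    fun i j h => ?_, fun X hX hi hp => ?_⟩, ⟨Iso.refl _⟩⟩
  · exact ε.symm.injective (Quotient.out_equiv_out.1 h)
  · have : Module.Finite Λᵐᵒᵖ X := hX
    have := hp.1
    obtain ⟨ι, _, a, b, hab⟩ := addRetract_regular hX
    obtain ⟨_, s, t, hst⟩ := exists_retract_of_indecomposable hi a b hab
    have key : ∑ i, (s ≫ e.hom ≫ biproduct.π Y i) ≫ biproduct.ι Y i ≫ e.inv ≫ t = 𝟙 X := by
      have : ∑ i, (s ≫ e.hom ≫ biproduct.π Y i) ≫ biproduct.ι Y i ≫ e.inv ≫ t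
          = s ≫ e.hom ≫ (∑ i, biproduct.π Y i ≫ biproduct.ι Y i) ≫ e.inv ≫ t := by
        simp only [Preadditive.sum_comp, Preadditive.comp_sum, Category.assoc]
      rw [this, biproduct.total, Category.id_comp, e.hom_inv_id_assoc, hst]
    obtain ⟨i, u, v, huv⟩ := exists_retract_of_indecomposable hi _ _ key
    obtain ⟨g⟩ := nonempty_iso_of_indecomposable_of_retract hi (hY i).2 u v huv
    let i' : S := ⟨i, Projective.of_iso g hp.1, Injective.of_iso g hp.2⟩
    refine ⟨ε ⟦i'⟧, ?_⟩
    have h : (⟦i'⟧ : Quotient r).out ≈ i' := Quotient.mk_out i'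
    obtain ⟨h⟩ := h
    refine ⟨g ≪≫ h.symm ≪≫ eqToIso ?_⟩
    simp only [P, Equiv.symm_apply_apply]

/-- An algebra of dominant dimension at least two, as witnessed by the beginning of an injective
coresolution of the regular module. -/
def HasDominantDimensionGETwo (Λ : Type u) [Ring Λ] : Prop :=
  ∃ (Q₀ Q₁ : RightMod Λ) (f : regular Λ ⟶ Q₀) (g : Q₀ ⟶ Q₁) (w : f ≫ g = 0),
    (IsFG Q₀ ∧ Projective Q₀ ∧ Injective Q₀) ∧ (IsFG Q₁ ∧ Projective Q₁ ∧ Injective Q₁) ∧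
      Mono f ∧ (ShortComplex.mk f g w).Exact

/-- The classical tilting module of an algebra of dominant dimension at least two. -/
theorem exists_tilting [IsNoetherianRing Λᵐᵒᵖ] [IsArtinianRing Λᵐᵒᵖ]
    (hdom : HasDominantDimensionGETwo Λ)
    (hgl : ∀ X : RightMod Λ, IsFG X → HasProjectiveDimensionLE X 2) :
    ∃ T Q : RightMod Λ, IsTilting T ∧ HasInjectiveDimensionLE T 1 ∧ IsSumOfProjInj Q ∧
      InGen Q T ∧ InCogen Q T := by
  obtain ⟨Q, hQ⟩ := exists_isSumOfProjInj (Λ := Λ)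
  obtain ⟨Q₀, Q₁, f, g, w, ⟨fg₀, _, _⟩, ⟨fg₁, _, _⟩, _, hex⟩ := hdom
  have := hQ.projective
  have := hQ.injective
  have hQfg : Module.Finite Λᵐᵒᵖ Q := hQ.isFG
  have : Module.Finite Λᵐᵒᵖ Q₀ := fg₀
  have : Module.Finite Λᵐᵒᵖ Q₁ := fg₁
  have r₀ : AddRetract Q Q₀ := hQ.addRetract fg₀
  have r₁ : AddRetract Q Q₁ := hQ.addRetract fg₁
  let Z := cokernel f
  let d : Z ⟶ Q₁ := cokernel.desc f g w
  have : Mono d := ShortComplex.Exact.mono_cokernelDesc hex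
  have hS := shortExact_cokernel f
  have hZ : Module.Finite Λᵐᵒᵖ Z := finite_of_epi (cokernel.π f)
  let T := Q ⊞ Z
  have hT : Module.Finite Λᵐᵒᵖ T := finite_biprod Q Z
  have rQ : AddRetract T Q := (AddRetract.refl T).of_retract biprod.inl biprod.fst (by simp)
  have rZ : AddRetract T Z := (AddRetract.refl T).of_retract biprod.inr biprod.snd (by simp)
  have pdZ : HasProjectiveDimensionLT Z 2 :=
    hS.hasProjectiveDimensionLT_X₃ 1 (inferInstanceAs (HasProjectiveDimensionLT (regular Λ) 1))
      (inferInstanceAs (HasProjectiveDimensionLT Q₀ 2))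
  have pdT : HasProjectiveDimensionLE T 1 :=
    inferInstanceAs (HasProjectiveDimensionLT (Q ⊞ Z) 2)
  let p : Q ⊞ Q₀ ⟶ T := biprod.map (𝟙 Q) (cokernel.π f)
  have : Epi p := inferInstanceAs (Epi (biprod.map (𝟙 Q) (cokernel.π f)))
  let i : T ⟶ Q ⊞ Q₁ := biprod.map (𝟙 Q) d
  have : Mono i := inferInstanceAs (Mono (biprod.map (𝟙 Q) d))
  refine ⟨T, Q, ⟨hT, pdT, ?_, ?_⟩, ?_, hQ, ?_, ?_⟩
  -- `T` is a quotient of the injective module `Q ⊞ Q₀`, and `pd T ≤ 1`.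
  · exact IsTilting.ext_of_epi pdT p (Abelian.Ext.subsingleton_of_injective T (Q ⊞ Q₀) 0)
  · exact ⟨Q₀, Z, (inAdd_iff hT).2 (rQ.trans r₀), (inAdd_iff hT).2 rZ, f, _, _, hS⟩
  · have hS' := shortExact_cokernel i
    -- Two dimension shifts: `Ext¹(X, cokernel i)` embeds in `Ext²(X, T)` since `Q ⊞ Q₁` is
    -- injective, and `Ext²(X, T)` embeds in `Ext³(X, kernel p) = 0` since `Q ⊞ Q₀` is injective.
    have hJ : Injective (cokernel i) := injective_of_subsingleton_ext fun X hX => by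
      have := hgl X hX
      refine subsingleton_ext_X₃ hS' X (Abelian.Ext.subsingleton_of_injective X (Q ⊞ Q₁) 0) ?_
      exact subsingleton_ext_X₃ (shortExact_kernel p) X
        (Abelian.Ext.subsingleton_of_injective X (Q ⊞ Q₀) 1)
        (HasProjectiveDimensionLT.subsingleton X 3 3 le_rfl _)
    exact hS'.hasInjectiveDimensionLT_X₁ 1
      (inferInstanceAs (HasInjectiveDimensionLT (cokernel i) 1))
      (inferInstanceAs (HasInjectiveDimensionLT (Q ⊞ Q₁) 2))
  · exact inGen_iff.2 ⟨hT, _, (AddRetract.refl Q).biprod r₀, p, inferInstance⟩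
  · exact inCogen_of_addRetract hT ((AddRetract.refl Q).biprod r₁) i

end ProjectiveInjective

/-! ### The duality module `D Λ` and embeddings into injectives. -/

section Dual

variable (k : Type u) [Field k] {Λ : Type u} [Ring Λ] [Algebra k Λ]


attribute [local instance] ModuleCat.moduleOfAlgebraModule
  ModuleCat.isScalarTower_of_algebra_moduleCat

/-- The homomorphism `X → D Λ` that corresponds to a linear form on `X`. -/
def dualHom {X : RightMod Λ} (φ : X →ₗ[k] k) : X ⟶ dualRegular k Λ :=
  ModuleCat.ofHom (Y := DualCarrier k Λ)
    { toFun := fun x =>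
        (φ ∘ₗ ((LinearMap.toSpanSingleton Λᵐᵒᵖ X x).restrictScalars k) ∘ₗ
          (MulOpposite.opLinearEquiv k : Λ ≃ₗ[k] Λᵐᵒᵖ).toLinearMap : Λ →ₗ[k] k)
      map_add' := fun x y => LinearMap.ext fun a => by
        change φ (op a • (x + y)) = φ (op a • x) + φ (op a • y)
        rw [smul_add, map_add]
      map_smul' := fun r x => LinearMap.ext fun a => by
        change φ (op a • r • x) = φ (op (r.unop * a) • x)
        rw [op_mul, op_unop, mul_smul] }

theorem dualHom_apply {X : RightMod Λ} (φ : X →ₗ[k] k) (x : X) (a : Λ) :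
    (show Λ →ₗ[k] k from (dualHom k φ).hom x) a = φ (op a • x) := rfl

/-- The linear form on `X` that corresponds to a homomorphism `X → D Λ`. -/
def formOfHom {X : RightMod Λ} (g : X ⟶ dualRegular k Λ) : X →ₗ[k] k where
  toFun x := (show Λ →ₗ[k] k from g.hom x) 1
  map_add' x y := by rw [map_add]; rfl
  map_smul' c x := by
    have h : c • x = algebraMap k Λᵐᵒᵖ c • x := rfl
    rw [h, map_smul]
    change (show Λ →ₗ[k] k from g.hom x) (algebraMap k Λ c * 1) = c • _
    rw [← Algebra.smul_def, map_smul]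

theorem dualHom_formOfHom {X : RightMod Λ} (g : X ⟶ dualRegular k Λ) :
    dualHom k (formOfHom k g) = g := by
  refine ModuleCat.hom_ext (LinearMap.ext fun x => LinearMap.ext fun (a : Λ) => ?_)
  change (show Λ →ₗ[k] k from g.hom (op a • x)) 1 = (show Λ →ₗ[k] k from g.hom x) a
  rw [map_smul]
  change (show Λ →ₗ[k] k from g.hom x) (a * 1) = _
  rw [mul_one]

/-- Maps into `D Λ` are the same as `k`-linear forms, and forms extend along injections of vector
spaces. -/
instance injective_dualRegular : Injective (dualRegular k Λ) where
  factors {X Y} g f _ := by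
    let f' : X →ₗ[k] Y := f.hom.restrictScalars k
    have hf : Function.Injective f' := (ModuleCat.mono_iff_injective f).1 inferInstance
    obtain ⟨r, hr⟩ := f'.exists_leftInverse_of_injective (LinearMap.ker_eq_bot.2 hf)
    refine ⟨dualHom k (formOfHom k g ∘ₗ r), ?_⟩
    rw [← dualHom_formOfHom k g]
    refine ModuleCat.hom_ext (LinearMap.ext fun x => LinearMap.ext fun (a : Λ) => ?_)
    change formOfHom k (dualHom k (formOfHom k g)) (r (op a • f.hom x)) = formOfHom k g (op a • x)
    rw [dualHom_formOfHom, ← map_smul]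
    exact congrArg (formOfHom k g) (LinearMap.congr_fun hr (op a • x))

variable [Module.Finite k Λ]

instance finite_dualRegular : Module.Finite Λᵐᵒᵖ (dualRegular k Λ) := by
  let : Module k (dualRegular k Λ) := inferInstanceAs (Module k (Λ →ₗ[k] k))
  have : Module.Finite k (dualRegular k Λ) := inferInstanceAs (Module.Finite k (Λ →ₗ[k] k))
  have : IsScalarTower k Λᵐᵒᵖ (dualRegular k Λ) := ⟨fun c a f => LinearMap.ext fun (x : Λ) => by
    change (show Λ →ₗ[k] k from f) ((c • a.unop) * x) = c • (show Λ →ₗ[k] k from f) (a.unop * x)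
    rw [smul_mul_assoc, map_smul]⟩
  exact Module.Finite.of_restrictScalars_finite k Λᵐᵒᵖ _

include k in
-- The coordinate forms of a `k`-basis give maps to `D Λ`; evaluating these at `1` recovers the
-- coordinates, so they are jointly injective.
theorem exists_mono_injective (X : RightMod Λ) [Module.Finite Λᵐᵒᵖ X] :
    ∃ (I : RightMod Λ) (f : X ⟶ I), IsFG I ∧ Injective I ∧ Mono f := by
  have : Module.Finite k X := Module.Finite.trans Λᵐᵒᵖ X
  let b := Module.finBasis k X
  refine ⟨⨁ fun _ : Fin (Module.finrank k X) => dualRegular k Λ,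
    biproduct.lift fun i => dualHom k (b.coord i), finite_biproduct _,
    injective_biproduct fun _ => inferInstance, ?_⟩
  rw [ModuleCat.mono_iff_injective, ← LinearMap.ker_eq_bot, LinearMap.ker_eq_bot']
  intro x hx
  rw [← b.forall_coord_eq_zero_iff]
  intro i
  have h : (biproduct.lift fun i => dualHom k (b.coord i)) ≫ biproduct.π _ i
    = dualHom k (b.coord i) := biproduct.lift_π _ _
  have h2 : (dualHom k (b.coord i)).hom x = 0 := by
    rw [← h, ModuleCat.hom_comp, LinearMap.comp_apply, hx, map_zero]
  have h3 := dualHom_apply k (b.coord i) x 1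
  rw [h2, op_one, one_smul] at h3
  exact h3.symm

end Dual

/-! ### The functor `Hom(G, -)` and the homological dimensions of `End G`. -/

theorem AddRetract.map {C D : Type*} [Category C] [Category D] [Preadditive C] [Preadditive D]
    (F : C ⥤ D) [F.Additive] {T X : C} (h : AddRetract T X) : AddRetract (F.obj T) (F.obj X) := by
  obtain ⟨ι, _, a, b, hab⟩ := h
  refine ⟨ι, inferInstance, fun i => F.map (a i), fun i => F.map (b i), ?_⟩
  rw [← F.map_id, ← hab, F.map_sum]
  simp only [F.map_comp]

section Generator

variable {Γ : Type u} [Ring Γ] {G : RightMod Γ}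

theorem isSeparator_of_addRetract_regular (h : AddRetract G (regular Γ)) : IsSeparator G := by
  rw [Preadditive.isSeparator_iff]
  intro X Y f hf
  obtain ⟨ι, _, a, b, hab⟩ := h
  refine ModuleCat.hom_ext (LinearMap.ext fun x => ?_)
  have key : regularHom x ≫ f = 0 := by
    calc regularHom x ≫ f = (∑ i, a i ≫ b i) ≫ regularHom x ≫ f := by rw [hab, Category.id_comp]
      _ = ∑ i, a i ≫ (b i ≫ regularHom x) ≫ f := by
        simp only [Preadditive.sum_comp, Category.assoc]
      _ = 0 := Finset.sum_eq_zero fun i _ => by rw [hf, comp_zero]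
  have h1 := congrArg (fun q : regular Γ ⟶ Y => q.hom (1 : Γ)) key
  have h2 : f.hom x = f.hom ((regularHom x).hom (1 : Γ)) :=
    congrArg f.hom (regularHom_apply_one x).symm
  exact h2.trans h1

variable {Λ : Type u} [Ring Λ] (e : Λ ≃+* End G)

/-- The functor `Hom(G, -)`, with values in right modules over a ring isomorphic to `End G`. -/
def homFunctor : RightMod Γ ⥤ RightMod Λ :=
  preadditiveCoyonedaObj G ⋙
    (ModuleCat.restrictScalarsEquivalenceOfRingEquiv (RingEquiv.op e)).functor

instance : (homFunctor e).Additive := by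
  unfold homFunctor
  infer_instance

instance : PreservesFiniteLimits (homFunctor e) := by
  unfold homFunctor
  have : PreservesLimits (preadditiveCoyonedaObj G) :=
    (IsGrothendieckAbelian.tensorObjPreadditiveCoyonedaObjAdjunction G).rightAdjoint_preservesLimits
  infer_instance

theorem homFunctor_full (hG : IsSeparator G) : (homFunctor e).Full := by
  have := IsGrothendieckAbelian.GabrielPopescu.full G hG
  unfold homFunctor
  infer_instance

/-- This is the exactness half of the Gabriel–Popescu theorem: the left adjoint preserves
monomorphisms, so `Hom(G, -)` preserves injectives. -/
theorem homFunctor_injective (hG : IsSeparator G) (I : RightMod Γ) [Injective I] :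
    Injective ((homFunctor e).obj I) := by
  have := IsGrothendieckAbelian.GabrielPopescu.preservesInjectiveObjects G hG
  have h : Injective ((preadditiveCoyonedaObj G).obj I) :=
    Functor.PreservesInjectiveObjects.injective_obj inferInstance
  exact ((ModuleCat.restrictScalarsEquivalenceOfRingEquiv (RingEquiv.op e)).map_injective_iff
    ((preadditiveCoyonedaObj G).obj I)).2 h

/-- `Hom(G, G)` is the regular module. -/
def homFunctorObjIso : (homFunctor e).obj G ≅ regular Λ :=
  (LinearEquiv.toModuleIso (R := Λᵐᵒᵖ) (X₁ := Λ) (X₂ := (homFunctor e).obj G)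
    { toFun := e
      invFun := e.symm
      left_inv := e.left_inv
      right_inv := e.right_inv
      -- Multiplication in `End G` is composition from right to left, so right multiplication
      -- corresponds to precomposition, the action on `Hom(G, G)`.
      map_add' := fun a b => map_add e a b
      map_smul' := fun r a => map_mul e a r.unop }).symm

end Generator

section Generator

variable {Γ : Type u} [Ring Γ] {G : RightMod Γ}
  (hG : ∀ X : RightMod Γ, IsFG X → AddRetract G X) {Λ : Type u} [Ring Λ] (e : Λ ≃+* End G)
include hG

theorem homFunctor_obj_addRetract {X : RightMod Γ} (hX : IsFG X) :
    AddRetract (regular Λ) ((homFunctor e).obj X) :=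
  ((AddRetract.refl _).of_iso (homFunctorObjIso e).symm).trans ((hG X hX).map _)

theorem homFunctor_obj_projective {X : RightMod Γ} (hX : IsFG X) :
    Projective ((homFunctor e).obj X) :=
  (homFunctor_obj_addRetract hG e hX).projective

theorem homFunctor_obj_isFG {X : RightMod Γ} (hX : IsFG X) : IsFG ((homFunctor e).obj X) :=
  (homFunctor_obj_addRetract hG e hX).finite

theorem isSeparator_of_forall_addRetract : IsSeparator G :=
  isSeparator_of_addRetract_regular (hG _ finite_regular)

include e in
-- By fullness a presentation of `X` by modules `Hom(G, B) → Hom(G, A)` is induced by some `φ : B ⟶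
-- A`. Left exactness identifies its kernel with `Hom(G, kernel φ)`, which is projective because
-- `kernel φ` lies in `add G`.
theorem projectiveDimension_le_two_of_auslander [IsNoetherianRing Γᵐᵒᵖ]
    [IsNoetherianRing Λᵐᵒᵖ] (hGfg : IsFG G) (X : RightMod Λ) (hX : IsFG X) :
    HasProjectiveDimensionLE X 2 := by
  have hfull := homFunctor_full e (isSeparator_of_forall_addRetract hG)
  have : Module.Finite Γᵐᵒᵖ G := hGfg
  have cover : ∀ Y : RightMod Λ, IsFG Y → ∃ (A : RightMod Γ) (p : (homFunctor e).obj A ⟶ Y),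
      IsFG A ∧ Epi p := by
    intro Y hY
    have : Module.Finite Λᵐᵒᵖ Y := hY
    obtain ⟨n, p, hp⟩ := exists_epi_regular Y
    refine ⟨⨁ fun _ : Fin n => G, ((homFunctor e).mapBiproduct _).hom ≫
      biproduct.map (fun _ => (homFunctorObjIso e).hom) ≫ p, finite_biproduct _, inferInstance⟩
  obtain ⟨A, p, hA, _⟩ := cover X hX
  have : Module.Finite Λᵐᵒᵖ ((homFunctor e).obj A) := homFunctor_obj_isFG hG e hA
  obtain ⟨B, q, hB, _⟩ := cover (kernel p) (finite_of_mono (kernel.ι p))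
  obtain ⟨φ, hφ⟩ := (homFunctor e).map_surjective (q ≫ kernel.ι p)
  have : Module.Finite Γᵐᵒᵖ B := hB
  have hK : Projective (kernel q) := by
    have i : kernel q ≅ (homFunctor e).obj (kernel φ) :=
      (kernelCompMono q (kernel.ι p)).symm ≪≫ kernelIsoOfEq hφ.symm ≪≫
        (PreservesKernel.iso (homFunctor e) φ).symm
    exact Projective.of_iso i.symm
      (homFunctor_obj_projective hG e (finite_of_mono (kernel.ι φ)))
  have := homFunctor_obj_projective hG e hA
  have := homFunctor_obj_projective hG e hB
  have h1 : HasProjectiveDimensionLT (kernel p) 2 :=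
    (shortExact_kernel q).hasProjectiveDimensionLT_X₃ 1
      (inferInstanceAs (HasProjectiveDimensionLT (kernel q) 1))
      (inferInstanceAs (HasProjectiveDimensionLT ((homFunctor e).obj B) 2))
  exact (shortExact_kernel p).hasProjectiveDimensionLT_X₃ 2 h1
    (inferInstanceAs (HasProjectiveDimensionLT ((homFunctor e).obj A) 3))

include e in
-- Apply `Hom(G, -)` to an injective copresentation `0 → G → I₀ → I₁`. The images of `I₀` and `I₁`
-- are projective because these lie in `add G`, and injective because `G` is a separator.
theorem hasDominantDimensionGETwo_of_auslander (k : Type u) [Field k] [Algebra k Γ]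
    [Module.Finite k Γ] (hGfg : IsFG G) : HasDominantDimensionGETwo Λ := by
  have hsep := isSeparator_of_forall_addRetract hG
  have : Module.Finite Γᵐᵒᵖ G := hGfg
  obtain ⟨I₀, f, hI₀, _, _⟩ := exists_mono_injective k G
  have : Module.Finite Γᵐᵒᵖ I₀ := hI₀
  have : Module.Finite Γᵐᵒᵖ (cokernel f : RightMod Γ) := finite_of_epi (cokernel.π f)
  obtain ⟨I₁, d, hI₁, _, _⟩ := exists_mono_injective k (cokernel f)
  let S := ShortComplex.mk f (cokernel.π f ≫ d) (by simp)
  have hS : S.Exact := by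
    have h := (shortExact_cokernel f).exact
    let φ : ShortComplex.mk f (cokernel.π f) (cokernel.condition f) ⟶ S :=
      { τ₁ := 𝟙 _, τ₂ := 𝟙 _, τ₃ := d }
    have h1 : Epi φ.τ₁ := inferInstanceAs (Epi (𝟙 _))
    have h2 : IsIso φ.τ₂ := inferInstanceAs (IsIso (𝟙 _))
    have h3 : Mono φ.τ₃ := inferInstanceAs (Mono d)
    exact (ShortComplex.exact_iff_of_epi_of_isIso_of_mono φ).1 h
  have hm : Mono S.f := inferInstanceAs (Mono f)
  have hS' : (S.map (homFunctor e)).Exact := hS.map_of_mono_of_preservesKernel _ hm inferInstance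
  let i := homFunctorObjIso e
  let S'' : ShortComplex (RightMod Λ) := ShortComplex.mk (i.inv ≫ (homFunctor e).map f)
    ((homFunctor e).map (cokernel.π f ≫ d)) (by
      rw [Category.assoc, ← Functor.map_comp, S.zero, Functor.map_zero, comp_zero])
  have ι : S.map (homFunctor e) ≅ S'' :=
    ShortComplex.isoMk i (Iso.refl _) (Iso.refl _)
      ((i.hom_inv_id_assoc _).trans (Category.comp_id _).symm)
      ((Category.id_comp _).trans (Category.comp_id _).symm)
  refine ⟨_, _, S''.f, S''.g, S''.zero,
    ⟨homFunctor_obj_isFG hG e hI₀, homFunctor_obj_projective hG e hI₀,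
      homFunctor_injective e hsep I₀⟩,
    ⟨homFunctor_obj_isFG hG e hI₁, homFunctor_obj_projective hG e hI₁,
      homFunctor_injective e hsep I₁⟩, ?_, (ShortComplex.exact_iff_of_iso ι).1 hS'⟩
  exact inferInstanceAs (Mono (i.inv ≫ (homFunctor e).map f))

end Generator

/-! ### Auslander algebras, uniqueness and the main theorem. -/

theorem IsCompleteFamily.addRetract {Γ : Type u} [Ring Γ] [IsNoetherianRing Γᵐᵒᵖ]
    [IsArtinianRing Γᵐᵒᵖ] {n : ℕ} {M : Fin n → RightMod Γ}
    (hM : IsCompleteFamily (fun _ => True) M) (X : RightMod Γ) (hX : IsFG X) :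
    AddRetract (⨁ M) X := by
  have : Module.Finite Γᵐᵒᵖ X := hX
  obtain ⟨m, Y, hY, ⟨f⟩⟩ := exists_iso_biproduct_indecomposable X
  refine (AddRetract.biproduct fun i => ?_).of_iso f.symm
  obtain ⟨j, ⟨g⟩⟩ := hM.complete (Y i) (hY i).1 (hY i).2 trivial
  exact (AddRetract.refl _).of_retract (g.hom ≫ biproduct.ι M j) (biproduct.π M j ≫ g.inv)
    (by simp)

namespace IsAuslanderAlgebra

variable {k : Type u} [Field k] {Λ : Type u} [Ring Λ] [Algebra k Λ]

theorem finite (hΛ : IsAuslanderAlgebra k Λ) : Module.Finite k Λ := by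
  obtain ⟨Γ, _, _, _, n, M, hM, ⟨e⟩⟩ := hΛ
  have : ∀ i, Module.Finite Γᵐᵒᵖ (M i) := hM.fg
  have h : Module.Finite k (End (⨁ M)) := finite_hom k (⨁ M) (⨁ M)
  exact Module.Finite.equiv e.symm.toLinearEquiv

theorem projectiveDimension_le_two (hΛ : IsAuslanderAlgebra k Λ) (X : RightMod Λ) (hX : IsFG X) :
    HasProjectiveDimensionLE X 2 := by
  have := hΛ.finite
  have := isNoetherianRing_op k (Λ := Λ)
  obtain ⟨Γ, _, _, _, n, M, hM, ⟨e⟩⟩ := hΛ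
  have := isNoetherianRing_op k (Λ := Γ)
  have := isArtinianRing_op k (Λ := Γ)
  have : ∀ i, Module.Finite Γᵐᵒᵖ (M i) := hM.fg
  exact projectiveDimension_le_two_of_auslander hM.addRetract e.toRingEquiv
    (finite_biproduct M) X hX

theorem hasDominantDimensionGETwo (hΛ : IsAuslanderAlgebra k Λ) :
    HasDominantDimensionGETwo Λ := by
  obtain ⟨Γ, _, _, _, n, M, hM, ⟨e⟩⟩ := hΛ
  have := isNoetherianRing_op k (Λ := Γ)
  have := isArtinianRing_op k (Λ := Γ)
  have : ∀ i, Module.Finite Γᵐᵒᵖ (M i) := hM.fg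
  exact hasDominantDimensionGETwo_of_auslander hM.addRetract e.toRingEquiv k (finite_biproduct M)

end IsAuslanderAlgebra

/-- `Q` is projective-injective, so it lies in `add T`; with `T ∈ Gen Q` the two classes coincide.
-/
theorem IsTilting.inGen_iff_of_inGen {Λ : Type u} [Ring Λ] [IsNoetherianRing Λᵐᵒᵖ]
    {T Q : RightMod Λ} (hT : IsTilting T) (hQ : IsSumOfProjInj Q) (h : InGen Q T)
    (X : RightMod Λ) : InGen T X ↔ InGen Q X := by
  have := hQ.projective
  have := hQ.injective
  exact ⟨h.trans, (inGen_of_addRetract hT.fg (hT.addRetract_of_projective_injective hQ.isFG)).trans⟩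

end AuslanderTilting

end

theorem mainTheorem3 (k : Type u) [Field k] [IsAlgClosed k] (Λ : Type u) [Ring Λ] [Algebra k Λ]
    (hΛ : AuslanderTilting.IsAuslanderAlgebra k Λ) :
    ∃ T : AuslanderTilting.RightMod Λ,
      AuslanderTilting.IsTilting T ∧
      AuslanderTilting.IsCotilting k T ∧
      AuslanderTilting.InC T ∧
      AuslanderTilting.HasHereditaryProperty T ∧
      ∀ T' : AuslanderTilting.RightMod Λ,
        AuslanderTilting.IsTilting T' → AuslanderTilting.InC T' →
          ∀ X : AuslanderTilting.RightMod Λ,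
            AuslanderTilting.InAdd T' X ↔ AuslanderTilting.InAdd T X := by
  have := hΛ.finite
  have := AuslanderTilting.isNoetherianRing_op k (Λ := Λ)
  have := AuslanderTilting.isArtinianRing_op k (Λ := Λ)
  obtain ⟨T, Q, hT, hid, hQ, hgen, hcogen⟩ :=
    AuslanderTilting.exists_tilting hΛ.hasDominantDimensionGETwo hΛ.projectiveDimension_le_two
  have hher := hT.hasHereditaryProperty k hid hΛ.projectiveDimension_le_two
  refine ⟨T, hT, ⟨hT.fg, hid, hT.ext_self, ?_⟩, ⟨Q, hQ, hgen, hcogen⟩, hher, ?_⟩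
  -- `D Λ` is injective, hence in `Gen T`, and the hereditary property supplies its resolution.
  · exact hher _ (hT.inGen_of_injective (AuslanderTilting.finite_dualRegular k))
  · rintro T' hT' ⟨Q', hQ', hgen', _⟩
    refine hT.inAdd_iff_of_inGen_iff k hT' fun X => ?_
    -- Both torsion classes are generated by projective-injectives; the choices `Q` and `Q'` lie in
    -- each other's additive closure.
    rw [hT.inGen_iff_of_inGen hQ hgen, hT'.inGen_iff_of_inGen hQ' hgen']
    have := hQ.projective
    have := hQ.injective
    have := hQ'.projective
    have := hQ'.injective
    exact ⟨(AuslanderTilting.inGen_of_addRetract hQ'.isFG (hQ'.addRetract hQ.isFG)).trans,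
      (AuslanderTilting.inGen_of_addRetract hQ.isFG (hQ.addRetract hQ'.isFG)).trans⟩
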